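/- For $n\ge 0$ let $a_n=\binom{2n}{n}^2$, and for integers $k,n\ge 0$ let $$M_n^{(k)}=\sum_{\substack{j_1,\dots,j_k\ge 0\\ j_1+\dots+j_k=n}} a_{j_1}\cdots a_{j_k}$$ be its $k$-fold convolution. For $|t|<1/16$ the generating function of $(a_n)$ converges and $$g(t)=\sum_{n=0}^\infty \binom{2n}{n}^2t^n=\frac{2}{\pi}\,K(16t),\qquad K(z)=\int_0^1\frac{dx}{\sqrt{(1-x^2)(1-zx^2)}} .$$ For every real $\kappa>0$, the function $t\mapsto \kappa\ln g(t)-\ln t$ on $(0,1/16)$ has a unique minimiser; call it $T_*(\kappa)$. Let $\kappa\in(0,\infty)$ and $$v(\kappa)=\left.\left(t\,\frac{d}{dt}\ln g(t)+t^2\,\frac{d^2}{dt^2}\ln g(t)\right)\right|_{t=T_*(\kappa)} .$$ Then, for every sequence $k=k_n$ of non-negative integers with $k_n/n\to\kappa$ as $n\to\infty$, $$M_n^{(k)}\sim e^{\,k\ln g(T_*(k/n))-n\ln T_*(k/n)}\,\frac{1}{\sqrt{2\pi k\,v(\kappa)}}\qquad (n\to\infty).$$ -/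

import Mathlib

open Filter Topology Asymptotics

noncomputable section

/-- The `k`-fold convolution `M_n^{(k)}(a)`: the sum of `a_{j_1} ⋯ a_{j_k}` over all
`(j_1, …, j_k) ∈ ℕ^k` with `j_1 + ⋯ + j_k = n`. -/
def multifoldConvolution (a : ℕ → ℝ) (k n : ℕ) : ℝ :=
  ∑ j ∈ Finset.Nat.antidiagonalTuple k n, ∏ i : Fin k, a (j i)

/-- The sequence `a_n = binom(2n, n)^2`. -/
def sqCentralBinom (n : ℕ) : ℝ := ((2 * n).choose n : ℝ) ^ 2

/-- The generating function `g(t) = ∑ a_n t^n` (used for `|t| < 1/16`, where it converges). -/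
def genFun (t : ℝ) : ℝ := ∑' n : ℕ, sqCentralBinom n * t ^ n

/-- The integrand of the complete elliptic integral of the first kind, with parameter `z`. -/
def ellipticIntegrand (z x : ℝ) : ℝ := 1 / √((1 - x ^ 2) * (1 - z * x ^ 2))

/-- The complete elliptic integral of the first kind, as a function of the parameter `z`
(the square of the modulus). -/
def ellipticK (z : ℝ) : ℝ := ∫ x in (0 : ℝ)..1, ellipticIntegrand z x

/-- The function `t ↦ κ ln g(t) - ln t`. -/
def circleObjective (κ t : ℝ) : ℝ := κ * Real.log (genFun t) - Real.log t

/-- `t` is an arg-min of `κ ln g - ln` over the interval `(0, 1/16)`. -/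
def IsCircleArgMin (κ t : ℝ) : Prop :=
  t ∈ Set.Ioo (0 : ℝ) (1 / 16) ∧ IsMinOn (circleObjective κ) (Set.Ioo (0 : ℝ) (1 / 16)) t

/-- `t (ln g)'(t) + t^2 (ln g)''(t)`. -/
def circleVariance (t : ℝ) : ℝ :=
  t * deriv (fun s => Real.log (genFun s)) t
    + t ^ 2 * iteratedDeriv 2 (fun s => Real.log (genFun s)) t

end

/-!
The convolution `M_n^{(k)}` is the coefficient of `t^n` in `g(t)^k`. For `t ∈ (0, 1/16)` let `X_t`
be the random variable on `ℕ` with `P(X_t = j) = a_j t^j / g(t)`. Then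
`M_n^{(k)} = g(t)^k t^{-n} P(S = n)`, where `S` is a sum of `k` independent copies of `X_t`
(`multifoldConvolution_tilt`).

The mean `m(t) = t g'(t) / g(t)` and the variance `v(t)` of `X_t` satisfy `t m'(t) = v(t) > 0`, so
`m` is strictly increasing. A critical point of `κ ln g - ln` is a solution of `κ m(t) = 1`, hence
unique; a minimiser exists because the objective tends to `+∞` at `0` (from `-ln t`) and at `1/16` (from
`g → ∞`, as `a_n / 16^n ≥ 1 / (4n)`). The expression `t (ln g)' + t² (ln g)''` is `v(t)`.

With `t = T_*(k/n)` the sum `S` has mean exactly `n`, and `P(S = n) ~ 1 / √(2π k v)` is a local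
limit theorem for a triangular array (`tendsto_sqrt_mul_multifoldConvolution`). By Fourier inversion,
`√k P(S = n)` is the integral over `|s| ≤ π√k` of `(2π)⁻¹ ψ(s / √k)^k`, with `ψ` the centred
characteristic function. Third moments bounded in `n` give `ψ(s / √k)^k → e^{-v s²/2}` pointwise
(`norm_trigSeries_mul_exp_sub_le`), and the atoms at `0` and `1` alone give the Gaussian domination
`|ψ(θ)| ≤ e^{-cθ²}` on `[-π, π]` (`norm_trigSeries_le`). Both are uniform near `T_*(κ)`, and
`T_*(k/n) → T_*(κ)` because `m` is strictly increasing.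

The identity `g(t) = (2/π) K(16t)` follows from the substitution `x = sin θ`, the binomial series of
`(1 - y)^{-1/2}` and Wallis' integrals (`hasSum_ellipticK`).
-/

/-! ### Powers of a power series and Fourier inversion -/

theorem multifoldConvolution_zero (a : ℕ → ℝ) (n : ℕ) :
    multifoldConvolution a 0 n = if n = 0 then 1 else 0 := by
  cases n <;> simp [multifoldConvolution]

theorem multifoldConvolution_succ (a : ℕ → ℝ) (k n : ℕ) :
    multifoldConvolution a (k + 1) n =
      ∑ q ∈ Finset.HasAntidiagonal.antidiagonal n, a q.1 * multifoldConvolution a k q.2 := by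
  simp only [multifoldConvolution, Finset.mul_sum]
  rw [Finset.sum_sigma']
  refine Finset.sum_bij' (fun x _ => ⟨(x 0, ∑ i, Fin.tail x i), Fin.tail x⟩)
    (fun y _ => Fin.cons y.1.1 y.2) ?_ ?_ ?_ ?_ ?_
  · intro x hx
    rw [Finset.Nat.mem_antidiagonalTuple, Fin.sum_univ_succ] at hx
    simp [Finset.Nat.mem_antidiagonalTuple, ← hx, Fin.tail]
  · rintro ⟨⟨i, j⟩, y⟩ h
    simp only [Finset.mem_sigma, Finset.HasAntidiagonal.mem_antidiagonal,
      Finset.Nat.mem_antidiagonalTuple] at h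
    simp [Finset.Nat.mem_antidiagonalTuple, Fin.sum_univ_succ, h.2, h.1]
  · intro x _
    simp
  · rintro ⟨⟨i, j⟩, y⟩ h
    simp only [Finset.mem_sigma, Finset.HasAntidiagonal.mem_antidiagonal,
      Finset.Nat.mem_antidiagonalTuple] at h
    simp [h.2]
  · intro x _
    simp [Fin.prod_univ_succ, Fin.tail]

/-- Exponential tilting commutes with convolution. -/
theorem multifoldConvolution_tilt (a : ℕ → ℝ) (t g : ℝ) (k n : ℕ) :
    multifoldConvolution (fun j => a j * t ^ j / g) k n =
      multifoldConvolution a k n * t ^ n / g ^ k := by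
  simp only [multifoldConvolution, Finset.sum_mul, Finset.sum_div]
  refine Finset.sum_congr rfl fun x hx => ?_
  rw [Finset.Nat.mem_antidiagonalTuple] at hx
  rw [Finset.prod_div_distrib, Finset.prod_mul_distrib, Finset.prod_pow_eq_pow_sum, hx]
  simp

/-- The `k`-fold convolution has the `k`-th power of the generating function as its generating
function, wherever the latter converges absolutely. -/
theorem multifoldConvolution_hasSum_pow (p : ℕ → ℝ) (z : ℂ)
    (hp : Summable fun j => ‖(p j : ℂ) * z ^ j‖) (k : ℕ) :
    (Summable fun n => ‖(multifoldConvolution p k n : ℂ) * z ^ n‖) ∧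
      ∑' n, (multifoldConvolution p k n : ℂ) * z ^ n = (∑' j, (p j : ℂ) * z ^ j) ^ k := by
  induction k with
  | zero =>
    have h : ∀ n, (multifoldConvolution p 0 n : ℂ) * z ^ n = if n = 0 then 1 else 0 := by
      intro n
      rw [multifoldConvolution_zero]
      split_ifs with h <;> simp [h]
    simp only [h]
    refine ⟨?_, by simp⟩
    refine summable_of_ne_finset_zero (s := {0}) fun n hn => ?_
    simp at hn
    simp [hn]
  | succ k ih =>
    have h : ∀ n, (multifoldConvolution p (k + 1) n : ℂ) * z ^ n =
        ∑ q ∈ Finset.HasAntidiagonal.antidiagonal n,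
          ((p q.1 : ℂ) * z ^ q.1) * ((multifoldConvolution p k q.2 : ℂ) * z ^ q.2) := by
      intro n
      rw [multifoldConvolution_succ]
      push_cast
      rw [Finset.sum_mul]
      refine Finset.sum_congr rfl fun q hq => ?_
      rw [Finset.HasAntidiagonal.mem_antidiagonal] at hq
      rw [← hq, pow_add]
      ring
    simp only [h]
    have h₁ := summable_norm_sum_mul_antidiagonal_of_summable_norm (f := fun j => (p j : ℂ) * z ^ j)
      (g := fun j => (multifoldConvolution p k j : ℂ) * z ^ j) hp ih.1
    have h₂ := tsum_mul_tsum_eq_tsum_sum_antidiagonal_of_summable_norm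
      (f := fun j => (p j : ℂ) * z ^ j)
      (g := fun j => (multifoldConvolution p k j : ℂ) * z ^ j) hp ih.1
    refine ⟨h₁, h₂.symm.trans ?_⟩
    rw [ih.2, pow_succ']

/-- The trigonometric series `∑ p_j e^{ijθ}`: the characteristic function of the distribution
with weights `p`. -/
noncomputable def trigSeries (p : ℕ → ℝ) (θ : ℝ) : ℂ :=
  ∑' j : ℕ, (p j : ℂ) * Complex.exp (θ * Complex.I) ^ j

theorem norm_mul_exp_pow (c : ℝ) (θ : ℝ) (j : ℕ) :
    ‖(c : ℂ) * Complex.exp (θ * Complex.I) ^ j‖ = |c| := by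
  rw [norm_mul, norm_pow, Complex.norm_exp_ofReal_mul_I, one_pow, mul_one, Complex.norm_real,
    Real.norm_eq_abs]

theorem continuous_trigSeries {p : ℕ → ℝ} (hp : Summable fun j => |p j|) :
    Continuous (trigSeries p) := by
  refine continuous_tsum (fun j => by fun_prop) hp fun j θ => (norm_mul_exp_pow _ _ _).le

theorem integral_exp_pow_mul_exp_neg (m n : ℕ) :
    ∫ θ in (-Real.pi)..Real.pi,
      Complex.exp (θ * Complex.I) ^ m * Complex.exp (-(n * θ * Complex.I)) =
      if m = n then (2 * Real.pi : ℂ) else 0 := by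
  have h : ∀ θ : ℝ, Complex.exp (θ * Complex.I) ^ m * Complex.exp (-(n * θ * Complex.I)) =
      Complex.exp ((((m : ℂ) - n) * Complex.I) * θ) := by
    intro θ
    rw [← Complex.exp_nat_mul, ← Complex.exp_add]
    congr 1
    ring
  simp only [h]
  split_ifs with hmn
  · subst hmn
    simp
    ring
  · have hc : ((m : ℂ) - n) * Complex.I ≠ 0 :=
      mul_ne_zero (sub_ne_zero.2 (by exact_mod_cast hmn)) Complex.I_ne_zero
    rw [integral_exp_mul_complex hc, div_eq_zero_iff, sub_eq_zero]
    left
    rw [Complex.exp_eq_exp_iff_exists_int]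
    refine ⟨(m : ℤ) - n, ?_⟩
    push_cast
    ring

/-- Fourier inversion: the convolution powers of `p` are the Fourier coefficients of the powers
of `trigSeries p`. -/
theorem integral_trigSeries_pow {p : ℕ → ℝ} (hp : Summable fun j => |p j|) (k n : ℕ) :
    ∫ θ in (-Real.pi)..Real.pi, trigSeries p θ ^ k * Complex.exp (-(n * θ * Complex.I)) =
      2 * Real.pi * multifoldConvolution p k n := by
  have hp' : ∀ θ : ℝ, Summable fun j => ‖(p j : ℂ) * Complex.exp (θ * Complex.I) ^ j‖ := by
    intro θ
    simpa only [norm_mul_exp_pow] using hp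
  have hs : Summable fun m => |multifoldConvolution p k m| := by
    simpa only [norm_mul_exp_pow] using (multifoldConvolution_hasSum_pow p _ (hp' 0) k).1
  have key := intervalIntegral.hasSum_integral_of_dominated_convergence
    (μ := MeasureTheory.volume) (a := -Real.pi) (b := Real.pi)
    (F := fun m θ => (multifoldConvolution p k m : ℂ) * Complex.exp (θ * Complex.I) ^ m
      * Complex.exp (-(n * θ * Complex.I)))
    (f := fun θ => trigSeries p θ ^ k * Complex.exp (-(n * θ * Complex.I)))
    (fun m _ => |multifoldConvolution p k m|)
    (fun m => (by fun_prop : Continuous _).aestronglyMeasurable)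
    (fun m => Filter.Eventually.of_forall fun θ _ => by
      rw [norm_mul, norm_mul_exp_pow, Complex.norm_exp]
      simp)
    (Filter.Eventually.of_forall fun θ _ => hs) intervalIntegrable_const
    (Filter.Eventually.of_forall fun θ _ => by
      have h := multifoldConvolution_hasSum_pow p _ (hp' θ) k
      rw [trigSeries, ← h.2]
      exact h.1.of_norm.hasSum.mul_right _)
  rw [← key.tsum_eq]
  simp only [mul_assoc, intervalIntegral.integral_const_mul]
  have := integral_exp_pow_mul_exp_neg
  simp only [mul_assoc] at this
  simp only [this]
  rw [tsum_eq_single n fun m hm => by simp [hm]]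
  simp
  ring

/-! ### A local limit theorem for triangular arrays -/

/-- A version of `Complex.tendsto_one_add_pow_exp_of_tendsto` for exponents running along an
arbitrary sequence tending to infinity. -/
theorem tendsto_one_add_pow_comp_exp {k : ℕ → ℕ} (hk : Tendsto k atTop atTop) {x : ℕ → ℂ} {z : ℂ}
    (hx : Tendsto (fun n => (k n : ℂ) * x n) atTop (𝓝 z)) :
    Tendsto (fun n => (1 + x n) ^ k n) atTop (𝓝 (Complex.exp z)) := by
  have hkR : Tendsto (fun n => (k n : ℝ)) atTop atTop := tendsto_natCast_atTop_atTop.comp hk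
  have hinv : Tendsto (fun n => ((k n : ℂ))⁻¹) atTop (𝓝 0) := by
    have := (Complex.continuous_ofReal.tendsto 0).comp (tendsto_inv_atTop_zero.comp hkR)
    simpa [Function.comp_def] using this
  have hpos : ∀ᶠ n in atTop, (k n : ℂ) ≠ 0 := by
    filter_upwards [hk.eventually_ge_atTop 1] with n hn
    exact_mod_cast (by omega : k n ≠ 0)
  have hx0 : Tendsto x atTop (𝓝 0) := by
    have := hinv.mul hx
    rw [zero_mul] at this
    refine this.congr' ?_
    filter_upwards [hpos] with n hn
    field_simp
  have hO : (fun n => Complex.log (1 + x n) - x n) =O[atTop] fun n => x n ^ 2 :=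
    Complex.log_sub_self_isBigO.comp_tendsto hx0
  have hdiff : Tendsto (fun n => (k n : ℂ) * (Complex.log (1 + x n) - x n)) atTop (𝓝 0) := by
    refine ((isBigO_refl (fun n => (k n : ℂ)) atTop).mul hO).trans_tendsto ?_
    have := hx.mul hx0
    rw [mul_zero] at this
    refine this.congr fun n => ?_
    ring
  have hlog : Tendsto (fun n => (k n : ℂ) * Complex.log (1 + x n)) atTop (𝓝 z) := by
    have := hdiff.add hx
    rw [zero_add] at this
    refine this.congr fun n => ?_
    ring
  refine ((Complex.continuous_exp.tendsto z).comp hlog).congr' ?_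
  have hne : ∀ᶠ n in atTop, 1 + x n ≠ 0 := by
    have : Tendsto (fun n => 1 + x n) atTop (𝓝 (1 + 0)) := tendsto_const_nhds.add hx0
    exact this.eventually_ne (by simp)
  filter_upwards [hne] with n hn
  rw [Function.comp_apply, Complex.exp_nat_mul, Complex.exp_log hn]

/-- The second-order Taylor remainder of `e^{iy}`, for all real `y`: the case `|y| ≤ 1` comes from
the exponential series, the case `|y| ≥ 1` from the triangle inequality. -/
theorem norm_exp_mul_I_sub_taylor_le (y : ℝ) :
    ‖Complex.exp (y * Complex.I) - 1 - y * Complex.I + y ^ 2 / 2‖ ≤ 4 * |y| ^ 3 := by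
  have hI : (y * Complex.I : ℂ) ^ 2 = -y ^ 2 := by
    rw [mul_pow, Complex.I_sq]; ring
  have hn : ‖(y * Complex.I : ℂ)‖ = |y| := by simp
  rcases le_total |y| 1 with h | h
  · have := Complex.norm_exp_sub_sum_le_norm_mul_exp (y * Complex.I) 3
    rw [hn] at this
    simp only [Finset.sum_range_succ, Finset.sum_range_zero, hI] at this
    have h1 : Real.exp |y| ≤ 4 := by
      have h2 := Real.exp_le_exp.2 h
      have := Real.exp_one_lt_d9
      linarith
    calc _ = _ := by
          congr 1
          norm_num [Nat.factorial]
          ring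
      _ ≤ _ := this
      _ ≤ |y| ^ 3 * 4 := by gcongr
      _ = _ := by ring
  · have h1 : ‖Complex.exp (y * Complex.I)‖ = 1 := Complex.norm_exp_ofReal_mul_I y
    have h2 : ‖(y ^ 2 / 2 : ℂ)‖ = |y| ^ 2 / 2 := by simp
    calc _ ≤ ‖Complex.exp (y * Complex.I)‖ + ‖(1 : ℂ)‖ + ‖(y * Complex.I : ℂ)‖
            + ‖(y ^ 2 / 2 : ℂ)‖ := by
          refine (norm_add_le _ _).trans ?_
          gcongr
          refine (norm_sub_le _ _).trans ?_
          gcongr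
          exact norm_sub_le _ _
      _ = 2 + |y| + |y| ^ 2 / 2 := by
          rw [h1, h2, hn, norm_one]; ring
      _ ≤ _ := by nlinarith [mul_nonneg (sub_nonneg.2 h) (sub_nonneg.2 h),
          mul_nonneg (sub_nonneg.2 h) (mul_nonneg (sub_nonneg.2 h) (sub_nonneg.2 h))]

/-- Two adjacent atoms already keep a characteristic function away from the unit circle,
with a Gaussian bound on the whole period. -/
theorem norm_trigSeries_le {p : ℕ → ℝ} (hp0 : ∀ j, 0 ≤ p j) (hp : HasSum p 1) {θ : ℝ}
    (hθ : |θ| ≤ Real.pi) :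
    ‖trigSeries p θ‖ ≤ Real.exp (-(p 0 * p 1 * (2 / Real.pi ^ 2) * θ ^ 2)) := by
  have hnorm : ∀ j, ‖(p j : ℂ) * Complex.exp (θ * Complex.I) ^ j‖ = p j := fun j => by
    rw [norm_mul_exp_pow, abs_of_nonneg (hp0 j)]
  have hsum : Summable fun j => ‖(p j : ℂ) * Complex.exp (θ * Complex.I) ^ j‖ := by
    simpa only [hnorm] using hp.summable
  have hsplit := hsum.of_norm.sum_add_tsum_nat_add 2
  have hsplit' := hp.summable.sum_add_tsum_nat_add 2
  rw [hp.tsum_eq] at hsplit'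
  simp only [Finset.sum_range_succ, Finset.sum_range_zero, pow_zero, pow_one, mul_one,
    zero_add] at hsplit hsplit'
  have htail : ‖∑' j, (p (j + 2) : ℂ) * Complex.exp (θ * Complex.I) ^ (j + 2)‖ ≤
      ∑' j, p (j + 2) := by
    have h := (summable_nat_add_iff 2).2 hsum
    refine (norm_tsum_le_tsum_norm h).trans_eq ?_
    simp only [hnorm]
  have htail0 : 0 ≤ ∑' j, p (j + 2) := tsum_nonneg fun j => hp0 _
  set c := Real.cos θ with hc
  have hc1 : c ≤ 1 := Real.cos_le_one θ
  have hc2 : -1 ≤ c := Real.neg_one_le_cos θ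
  have h0 := hp0 0
  have h1 := hp0 1
  have h01 : 0 ≤ p 0 * p 1 := mul_nonneg h0 h1
  have hA : p 0 + p 1 ≤ 1 := by linarith
  -- `|p₀ + p₁ e^{iθ}|² = (p₀ + p₁)² - 2 p₀ p₁ (1 - cos θ)`, and
  -- `√(A² - 2B) ≤ A - B` for `0 ≤ B ≤ A ≤ 1`
  have hhead : ‖(p 0 : ℂ) + p 1 * Complex.exp (θ * Complex.I)‖ ≤
      p 0 + p 1 - p 0 * p 1 * (1 - c) := by
    have hB : 0 ≤ p 0 + p 1 - p 0 * p 1 * (1 - c) := by nlinarith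
    refine abs_le_of_sq_le_sq' ?_ hB |>.2
    have : ‖(p 0 : ℂ) + p 1 * Complex.exp (θ * Complex.I)‖ ^ 2 =
        (p 0 + p 1) ^ 2 - 2 * (p 0 * p 1 * (1 - c)) := by
      rw [← Complex.normSq_eq_norm_sq, Complex.normSq_apply, Complex.exp_mul_I]
      simp [← Complex.ofReal_cos, ← Complex.ofReal_sin]
      linear_combination p 1 ^ 2 * Real.sin_sq_add_cos_sq θ
    rw [this]
    have hB' : 0 ≤ p 0 * p 1 * (1 - c) := mul_nonneg h01 (by linarith)
    nlinarith [sq_nonneg (p 0 * p 1 * (1 - c)), mul_nonneg hB' (sub_nonneg.2 hA)]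
  have hcos : 2 / Real.pi ^ 2 * θ ^ 2 ≤ 1 - c := by
    have := Real.cos_le_one_sub_mul_cos_sq hθ
    linarith
  calc ‖trigSeries p θ‖ ≤ (p 0 + p 1 - p 0 * p 1 * (1 - c)) + ∑' j, p (j + 2) := by
        rw [trigSeries, ← hsplit]
        exact (norm_add_le _ _).trans (add_le_add hhead htail)
    _ = 1 - p 0 * p 1 * (1 - c) := by linarith
    _ ≤ 1 - p 0 * p 1 * (2 / Real.pi ^ 2 * θ ^ 2) := by
        have := mul_le_mul_of_nonneg_left hcos h01
        linarith
    _ ≤ _ := by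
        have := Real.add_one_le_exp (-(p 0 * p 1 * (2 / Real.pi ^ 2) * θ ^ 2))
        refine le_trans (le_of_eq ?_) this
        ring

/-- Second-order expansion of a centred characteristic function, with an error controlled by the
third absolute central moment. -/
theorem norm_trigSeries_mul_exp_sub_le {p : ℕ → ℝ} (hp0 : ∀ j, 0 ≤ p j) (hp : HasSum p 1)
    {m v C : ℝ} (hm : HasSum (fun j : ℕ => p j * j) m)
    (hv : HasSum (fun j : ℕ => p j * (j - m) ^ 2) v)
    (hs : Summable fun j : ℕ => p j * |j - m| ^ 3)
    (hC : ∑' j : ℕ, p j * |j - m| ^ 3 ≤ C) (θ : ℝ) :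
    ‖trigSeries p θ * Complex.exp (-(m * θ * Complex.I)) - (1 - v * θ ^ 2 / 2)‖ ≤
      4 * C * |θ| ^ 3 := by
  have hsum : Summable fun j => (p j : ℂ) * Complex.exp (θ * Complex.I) ^ j := by
    refine Summable.of_norm ?_
    simp only [norm_mul_exp_pow]
    exact hp.summable.abs
  have h1 : HasSum (fun j => (p j : ℂ) * Complex.exp (((j - m) * θ : ℝ) * Complex.I))
      (trigSeries p θ * Complex.exp (-(m * θ * Complex.I))) := by
    refine (hsum.hasSum.mul_right (Complex.exp (-(m * θ * Complex.I)))).congr_fun fun j => ?_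
    rw [mul_assoc, ← Complex.exp_nat_mul, ← Complex.exp_add]
    congr 2
    push_cast
    ring
  have hcen : HasSum (fun j : ℕ => p j * (j - m)) 0 := by
    have := hm.sub (hp.mul_right m)
    simp only [one_mul, sub_self] at this
    exact this.congr_fun fun j => by ring
  have h2 : HasSum (fun j => (p j : ℂ) * (Complex.exp (((j - m) * θ : ℝ) * Complex.I) - 1
      - ((j - m) * θ : ℝ) * Complex.I + ((j - m) * θ : ℝ) ^ 2 / 2))
      (trigSeries p θ * Complex.exp (-(m * θ * Complex.I)) - (1 - v * θ ^ 2 / 2)) := by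
    have e1 := Complex.hasSum_ofReal.2 hp
    have e2 := (Complex.hasSum_ofReal.2 hcen).mul_right (θ * Complex.I)
    have e3 := (Complex.hasSum_ofReal.2 hv).mul_right (θ ^ 2 / 2 : ℂ)
    have := ((h1.sub e1).sub e2).add e3
    convert! this using 1
    · ext j; push_cast; ring
    · push_cast; ring
  have hbound : ∀ j : ℕ, ‖(p j : ℂ) * (Complex.exp (((j - m) * θ : ℝ) * Complex.I) - 1
      - ((j - m) * θ : ℝ) * Complex.I + ((j - m) * θ : ℝ) ^ 2 / 2)‖ ≤
      4 * |θ| ^ 3 * (p j * |j - m| ^ 3) := by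
    intro j
    rw [norm_mul, Complex.norm_real, Real.norm_eq_abs, abs_of_nonneg (hp0 j)]
    calc _ ≤ p j * (4 * |(j - m) * θ| ^ 3) :=
          mul_le_mul_of_nonneg_left (norm_exp_mul_I_sub_taylor_le _) (hp0 j)
      _ = _ := by rw [abs_mul]; ring
  rw [← h2.tsum_eq]
  refine (tsum_of_norm_bounded (hs.hasSum.mul_left _) hbound).trans ?_
  have : 0 ≤ |θ| ^ 3 := by positivity
  nlinarith

/-- **Local limit theorem** at the mean, for a triangular array: if the distributions `p n` on `ℕ`
have mean `N n / k n`, variances tending to `v > 0`, bounded third moments, and atoms at `0` and `1`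
bounded below, then the `k n`-fold convolution of `p n` has mass `≈ 1 / √(2π v k n)` at `N n`. -/
theorem tendsto_sqrt_mul_multifoldConvolution {p : ℕ → ℕ → ℝ} {k N : ℕ → ℕ} {V : ℕ → ℝ}
    {v c C : ℝ} (hk : Tendsto k atTop atTop) (hc : 0 < c) (hv : 0 < v)
    (hp0 : ∀ᶠ n in atTop, ∀ j, 0 ≤ p n j) (hp : ∀ᶠ n in atTop, HasSum (p n) 1)
    (hm : ∀ᶠ n in atTop, HasSum (fun j : ℕ => p n j * j) (N n / k n : ℝ))
    (hV : ∀ᶠ n in atTop, HasSum (fun j : ℕ => p n j * (j - N n / k n) ^ 2) (V n))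
    (hs : ∀ᶠ n in atTop, Summable fun j : ℕ => p n j * |(j : ℝ) - N n / k n| ^ 3)
    (hC : ∀ᶠ n in atTop, ∑' j : ℕ, p n j * |(j : ℝ) - N n / k n| ^ 3 ≤ C)
    (hc' : ∀ᶠ n in atTop, c ≤ p n 0 * p n 1) (hVv : Tendsto V atTop (𝓝 v)) :
    Tendsto (fun n => √(k n) * multifoldConvolution (p n) (k n) (N n)) atTop
      (𝓝 (1 / √(2 * Real.pi * v))) := by
  have hkR : Tendsto (fun n => (k n : ℝ)) atTop atTop := tendsto_natCast_atTop_atTop.comp hk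
  have hsq : Tendsto (fun n => √(k n : ℝ)) atTop atTop := Real.tendsto_sqrt_atTop.comp hkR
  have hkpos : ∀ᶠ n in atTop, 0 < (k n : ℝ) := hkR.eventually_gt_atTop 0
  -- the centred characteristic function
  set ψ : ℕ → ℝ → ℂ := fun n θ =>
    trigSeries (p n) θ * Complex.exp (-(((N n / k n : ℝ) : ℂ) * θ * Complex.I)) with hψ
  -- the rescaled integrand
  set F : ℕ → ℝ → ℂ := fun n => (Set.Ioc (-Real.pi * √(k n)) (Real.pi * √(k n))).indicator
    (fun s => ψ n (s / √(k n)) ^ k n) with hF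
  -- Fourier inversion; the phase `e^{-iNθ}` is absorbed into the centring since
  -- `N n` is `k n` times the mean
  have hint : ∀ᶠ n in atTop, ∫ s, F n s =
      2 * Real.pi * ((√(k n) * multifoldConvolution (p n) (k n) (N n) : ℝ) : ℂ) := by
    filter_upwards [hkpos, hp] with n hn hpn
    have hq : (0 : ℝ) < √(k n) := Real.sqrt_pos.2 hn
    have hle : -Real.pi * √(k n) ≤ Real.pi * √(k n) := by nlinarith [Real.pi_pos]
    rw [hF, MeasureTheory.integral_indicator measurableSet_Ioc,
      ← intervalIntegral.integral_of_le hle,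
      intervalIntegral.integral_comp_div (fun θ => ψ n θ ^ k n) hq.ne',
      mul_div_cancel_right₀ _ hq.ne', mul_div_cancel_right₀ _ hq.ne']
    have hpow : ∀ θ : ℝ, ψ n θ ^ k n =
        trigSeries (p n) θ ^ k n * Complex.exp (-(N n * θ * Complex.I)) := by
      intro θ
      simp only [hψ]
      rw [mul_pow, ← Complex.exp_nat_mul]
      congr 2
      have : (k n : ℂ) ≠ 0 := by exact_mod_cast hn.ne'
      push_cast
      field_simp
    simp only [hpow]
    rw [integral_trigSeries_pow hpn.summable.abs, Complex.real_smul]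
    push_cast
    ring
  have hmeas : ∀ᶠ n in atTop, MeasureTheory.AEStronglyMeasurable (F n) := by
    filter_upwards [hp] with n hpn
    have := continuous_trigSeries hpn.summable.abs
    have hcont : Continuous fun s : ℝ => ψ n (s / √(k n)) ^ k n := by
      simp only [hψ]
      fun_prop
    exact hcont.aestronglyMeasurable.indicator measurableSet_Ioc
  have hdom : ∀ᶠ n in atTop, ∀ᵐ s : ℝ, ‖F n s‖ ≤ Real.exp (-(c * (2 / Real.pi ^ 2)) * s ^ 2) := by
    filter_upwards [hkpos, hp, hp0, hc'] with n hn hpn hpn0 hcn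
    refine Eventually.of_forall fun s => ?_
    have hq : (0 : ℝ) < √(k n) := Real.sqrt_pos.2 hn
    by_cases hmem : s ∈ Set.Ioc (-Real.pi * √(k n)) (Real.pi * √(k n))
    · rw [hF]
      simp only [Set.indicator_of_mem hmem]
      have hθ : |s / √(k n)| ≤ Real.pi := by
        rw [abs_le, le_div_iff₀ hq, div_le_iff₀ hq]
        exact ⟨hmem.1.le, hmem.2⟩
      have h1 : ‖ψ n (s / √(k n))‖ ≤
          Real.exp (-(c * (2 / Real.pi ^ 2) * (s / √(k n)) ^ 2)) := by
        simp only [hψ]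
        rw [norm_mul, Complex.norm_exp]
        have : (-(((N n / k n : ℝ) : ℂ) * ((s / √(k n) : ℝ) : ℂ) * Complex.I)).re = 0 := by
          rw [← Complex.ofReal_mul]; simp
        rw [this, Real.exp_zero, mul_one]
        refine (norm_trigSeries_le hpn0 hpn hθ).trans (Real.exp_le_exp.2 ?_)
        gcongr
      calc ‖ψ n (s / √(k n)) ^ k n‖ = ‖ψ n (s / √(k n))‖ ^ k n := norm_pow _ _
        _ ≤ Real.exp (-(c * (2 / Real.pi ^ 2) * (s / √(k n)) ^ 2)) ^ k n := by gcongr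
        _ = _ := by
          rw [← Real.exp_nat_mul, div_pow, Real.sq_sqrt hn.le]
          congr 1
          field_simp
    · rw [hF]
      simp only [Set.indicator_of_notMem hmem, norm_zero]
      positivity
  have hlim : ∀ s : ℝ, Tendsto (fun n => F n s) atTop
      (𝓝 (Complex.exp (((-(v / 2) * s ^ 2 : ℝ)) : ℂ))) := by
    intro s
    have hmem : ∀ᶠ n in atTop, s ∈ Set.Ioc (-Real.pi * √(k n)) (Real.pi * √(k n)) := by
      filter_upwards [(hsq.const_mul_atTop Real.pi_pos).eventually_gt_atTop |s|] with n hn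
      rw [abs_lt] at hn
      exact ⟨by linarith, hn.2.le⟩
    have hx : Tendsto (fun n => (k n : ℂ) * (ψ n (s / √(k n)) - 1)) atTop
        (𝓝 ((-(v / 2) * s ^ 2 : ℝ) : ℂ)) := by
      have hmain : Tendsto (fun n => ((-(V n / 2) * s ^ 2 : ℝ) : ℂ)) atTop
          (𝓝 ((-(v / 2) * s ^ 2 : ℝ) : ℂ)) :=
        (Complex.continuous_ofReal.tendsto _).comp ((hVv.div_const 2).neg.mul_const _)
      have herr : Tendsto (fun n => (k n : ℂ) * (ψ n (s / √(k n)) - 1)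
          - ((-(V n / 2) * s ^ 2 : ℝ) : ℂ)) atTop (𝓝 0) := by
        have hb : Tendsto (fun n => 4 * C * |s| ^ 3 * (√(k n : ℝ))⁻¹) atTop (𝓝 0) := by
          simpa using (tendsto_inv_atTop_zero.comp hsq).const_mul (4 * C * |s| ^ 3)
        refine squeeze_zero_norm' ?_ hb
        filter_upwards [hkpos, hp0, hp, hm, hV, hs, hC] with n hn h1 h2 h3 h4 h5 h6
        have hq : (0 : ℝ) < √(k n) := Real.sqrt_pos.2 hn
        have hqq : √(k n : ℝ) * √(k n : ℝ) = k n := Real.mul_self_sqrt hn.le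
        have := norm_trigSeries_mul_exp_sub_le h1 h2 h3 h4 h5 h6 (s / √(k n))
        have heq : (k n : ℂ) * (ψ n (s / √(k n)) - 1) - ((-(V n / 2) * s ^ 2 : ℝ) : ℂ) =
            (k n : ℂ) * (ψ n (s / √(k n)) - (1 - V n * ((s / √(k n) : ℝ) : ℂ) ^ 2 / 2)) := by
          have hkc : (k n : ℂ) * ((s / √(k n) : ℝ) : ℂ) ^ 2 = (s : ℂ) ^ 2 := by
            have : (k n : ℝ) * (s / √(k n)) ^ 2 = s ^ 2 := by
              rw [div_pow, Real.sq_sqrt hn.le]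
              field_simp
            exact_mod_cast this
          push_cast at hkc ⊢
          linear_combination (-(V n : ℂ) / 2) * hkc
        rw [heq, norm_mul, Complex.norm_natCast]
        calc (k n : ℝ) * _ ≤ k n * (4 * C * |s / √(k n)| ^ 3) := by gcongr
          _ = 4 * C * |s| ^ 3 * (√(k n : ℝ))⁻¹ := by
            rw [abs_div, abs_of_pos hq, div_pow]
            generalize √(k n : ℝ) = q at hq hqq ⊢
            rw [← hqq]
            field_simp
      have := herr.add hmain
      rw [zero_add] at this
      exact this.congr fun n => by ring
    refine (tendsto_one_add_pow_comp_exp hk hx).congr' ?_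
    filter_upwards [hmem] with n hn
    rw [hF]
    simp only [Set.indicator_of_mem hn]
    congr 1
    ring
  have hconv := MeasureTheory.tendsto_integral_filter_of_dominated_convergence
    (μ := MeasureTheory.volume) (fun s : ℝ => Real.exp (-(c * (2 / Real.pi ^ 2)) * s ^ 2))
    hmeas hdom (integrable_exp_neg_mul_sq (by positivity)) (Eventually.of_forall hlim)
  have hgauss : ∫ s : ℝ, Complex.exp ((-(v / 2) * s ^ 2 : ℝ) : ℂ) =
      ((√(Real.pi / (v / 2)) : ℝ) : ℂ) := by
    rw [← integral_gaussian (v / 2), ← integral_complex_ofReal]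
    simp only [Complex.ofReal_exp]
  rw [hgauss] at hconv
  have hre := (Complex.continuous_re.tendsto _).comp hconv
  have hpi := Real.pi_pos
  have hval : √(Real.pi / (v / 2)) / (2 * Real.pi) = 1 / √(2 * Real.pi * v) := by
    rw [div_eq_div_iff (by positivity) (by positivity), ← Real.sqrt_mul (by positivity)]
    rw [show Real.pi / (v / 2) * (2 * Real.pi * v) = (2 * Real.pi) ^ 2 by field_simp,
      Real.sqrt_sq (by positivity), one_mul]
  rw [← hval]
  refine (hre.div_const (2 * Real.pi)).congr' ?_
  filter_upwards [hint] with n hn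
  rw [Function.comp_apply, hn, ← Complex.ofReal_ofNat, ← Complex.ofReal_mul, ← Complex.ofReal_mul,
    Complex.ofReal_re]
  field_simp

/-! ### The elliptic integral -/

theorem centralBinom_succ_div_four_pow (n : ℕ) :
    ((n + 1).centralBinom : ℝ) / 4 ^ (n + 1) =
      (n.centralBinom : ℝ) / 4 ^ n * ((2 * n + 1) / (2 * n + 2)) := by
  have h : ((n : ℝ) + 1) * (n + 1).centralBinom = 2 * (2 * n + 1) * n.centralBinom := by
    exact_mod_cast Nat.succ_mul_centralBinom_succ n
  rw [pow_succ]
  field_simp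
  linear_combination 2 * h

theorem centralBinom_div_four_pow_eq_prod (n : ℕ) :
    (n.centralBinom : ℝ) / 4 ^ n = ∏ i ∈ Finset.range n, (2 * (i : ℝ) + 1) / (2 * i + 2) := by
  induction n with
  | zero => simp
  | succ n ih => rw [centralBinom_succ_div_four_pow, Finset.prod_range_succ, ih]

theorem centralBinom_div_four_pow_le_one (n : ℕ) : (n.centralBinom : ℝ) / 4 ^ n ≤ 1 := by
  rw [div_le_one (by positivity)]
  exact_mod_cast Nat.centralBinom_le_four_pow n

theorem sqCentralBinom_eq (n : ℕ) :
    sqCentralBinom n = 16 ^ n * ((n.centralBinom : ℝ) / 4 ^ n) ^ 2 := by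
  rw [sqCentralBinom, ← Nat.centralBinom_eq_two_mul_choose, div_pow, ← pow_mul, mul_comm n 2,
    pow_mul]
  norm_num
  field_simp

theorem ringChoose_neg_half (n : ℕ) :
    Ring.choose (-(1 / 2) : ℝ) n = (-1) ^ n * ((n.centralBinom : ℝ) / 4 ^ n) := by
  have hrec : ∀ n : ℕ, Ring.choose (-(1 / 2) : ℝ) (n + 1) =
      Ring.choose (-(1 / 2) : ℝ) n * ((-(1 / 2) - n) / (n + 1)) := by
    intro n
    have h := Ring.choose_smul_choose (-(1 / 2) : ℝ) (Nat.le_succ n)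
    rw [Nat.succ_eq_add_one, Nat.add_sub_cancel_left, Ring.choose_one_right,
      Nat.choose_succ_self_right, nsmul_eq_mul] at h
    push_cast at h
    field_simp
    linear_combination 2 * h
  induction n with
  | zero => simp
  | succ n ih =>
    rw [hrec, ih, centralBinom_succ_div_four_pow, pow_succ]
    field_simp
    ring

theorem hasSum_centralBinom_mul_pow {y : ℝ} (hy : |y| < 1) :
    HasSum (fun n : ℕ => (n.centralBinom : ℝ) / 4 ^ n * y ^ n) (1 / √(1 - y)) := by
  have h := (Real.one_add_rpow_hasFPowerSeriesOnBall_zero (a := -(1 / 2))).hasSum (y := -y)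
    (by simpa [enorm_eq_nnnorm, ← NNReal.coe_lt_one] using hy)
  have h1 : 0 < 1 - y := by linarith [(abs_lt.1 hy).2]
  rw [Real.sqrt_eq_rpow, one_div, ← Real.rpow_neg h1.le]
  convert! h using 1
  · ext n
    rw [binomialSeries_apply, ringChoose_neg_half, List.ofFn_const, List.prod_replicate,
      smul_eq_mul, neg_pow y]
    have : ((-1 : ℝ) ^ n) * (-1) ^ n = 1 := by rw [← mul_pow]; simp
    linear_combination (-((n.centralBinom : ℝ) / 4 ^ n) * y ^ n) * this
  · ring_nf

theorem integral_zero_pi_eq_two_mul {f : ℝ → ℝ}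
    (hf : Continuous fun θ => f (Real.sin θ)) :
    ∫ θ in (0 : ℝ)..Real.pi, f (Real.sin θ) =
      2 * ∫ θ in (0 : ℝ)..(Real.pi / 2), f (Real.sin θ) := by
  have hi : ∀ a b : ℝ, IntervalIntegrable (fun θ => f (Real.sin θ)) MeasureTheory.volume a b :=
    fun a b => hf.intervalIntegrable a b
  rw [← intervalIntegral.integral_add_adjacent_intervals (hi 0 (Real.pi / 2)) (hi _ _), two_mul]
  congr 1
  have := intervalIntegral.integral_comp_sub_left (a := 0) (b := Real.pi / 2)
    (fun θ => f (Real.sin θ)) Real.pi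
  simp only [Real.sin_pi_sub] at this
  rw [this]
  congr 1
  · ring
  · ring

theorem one_sub_mul_sin_sq_pos {z : ℝ} (hz : |z| < 1) (θ : ℝ) : 0 < 1 - z * Real.sin θ ^ 2 := by
  have h1 : Real.sin θ ^ 2 ≤ 1 := Real.sin_sq_le_one θ
  have h2 : 0 ≤ Real.sin θ ^ 2 := sq_nonneg _
  obtain ⟨h3, h4⟩ := abs_lt.1 hz
  nlinarith

/-- The substitution `x = sin θ` turns the elliptic integrand into a continuous function. -/
theorem ellipticIntegrand_comp_sin {z θ : ℝ} (hz : |z| < 1)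
    (hθ : θ ∈ Set.Ioo (0 : ℝ) (Real.pi / 2)) :
    |Real.cos θ| • ellipticIntegrand z (Real.sin θ) = 1 / √(1 - z * Real.sin θ ^ 2) := by
  have hc : 0 < Real.cos θ := Real.cos_pos_of_mem_Ioo ⟨by linarith [hθ.1, Real.pi_pos], hθ.2⟩
  have hs : 0 < √(1 - z * Real.sin θ ^ 2) := Real.sqrt_pos.2 (one_sub_mul_sin_sq_pos hz θ)
  rw [ellipticIntegrand, ← Real.cos_sq', Real.sqrt_mul (sq_nonneg _), Real.sqrt_sq hc.le,
    abs_of_pos hc, smul_eq_mul]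
  field_simp

theorem sin_image_Ioo : Real.sin '' Set.Ioo 0 (Real.pi / 2) = Set.Ioo 0 1 := by
  ext x
  constructor
  · rintro ⟨θ, hθ, rfl⟩
    refine ⟨Real.sin_pos_of_pos_of_lt_pi hθ.1 (by linarith [hθ.2, Real.pi_pos]), ?_⟩
    rw [← Real.sin_pi_div_two]
    exact Real.sin_lt_sin_of_lt_of_le_pi_div_two (by linarith [hθ.1, Real.pi_pos]) le_rfl hθ.2
  · rintro ⟨h0, h1⟩
    exact ⟨Real.arcsin x, ⟨Real.arcsin_pos.2 h0, Real.arcsin_lt_pi_div_two.2 h1⟩,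
      Real.sin_arcsin (by linarith) h1.le⟩

theorem continuous_one_div_sqrt_sin {z : ℝ} (hz : |z| < 1) :
    Continuous fun θ : ℝ => 1 / √(1 - z * Real.sin θ ^ 2) := by
  refine continuous_const.div (by fun_prop) fun θ => ?_
  exact (Real.sqrt_pos.2 (one_sub_mul_sin_sq_pos hz θ)).ne'

theorem injOn_sin_Ioo : Set.InjOn Real.sin (Set.Ioo 0 (Real.pi / 2)) :=
  Real.injOn_sin.mono fun _ h => Set.mem_Icc.2 ⟨by linarith [h.1, Real.pi_pos], h.2.le⟩

theorem intervalIntegrable_ellipticIntegrand {z : ℝ} (hz : |z| < 1) :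
    IntervalIntegrable (ellipticIntegrand z) MeasureTheory.volume 0 1 := by
  rw [intervalIntegrable_iff_integrableOn_Ioo_of_le zero_le_one, ← sin_image_Ioo,
    MeasureTheory.integrableOn_image_iff_integrableOn_abs_deriv_smul measurableSet_Ioo
      (fun θ _ => (Real.hasDerivAt_sin θ).hasDerivWithinAt) injOn_sin_Ioo]
  refine MeasureTheory.IntegrableOn.congr_fun ?_
    (fun θ hθ => (ellipticIntegrand_comp_sin hz hθ).symm) measurableSet_Ioo
  rw [← intervalIntegrable_iff_integrableOn_Ioo_of_le (by positivity)]
  exact (continuous_one_div_sqrt_sin hz).intervalIntegrable _ _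

theorem ellipticK_eq_integral_sin {z : ℝ} (hz : |z| < 1) :
    ellipticK z = ∫ θ in (0 : ℝ)..(Real.pi / 2), 1 / √(1 - z * Real.sin θ ^ 2) := by
  rw [ellipticK, intervalIntegral.integral_of_le zero_le_one,
    MeasureTheory.integral_Ioc_eq_integral_Ioo, ← sin_image_Ioo,
    MeasureTheory.integral_image_eq_integral_abs_deriv_smul measurableSet_Ioo
      (fun θ _ => (Real.hasDerivAt_sin θ).hasDerivWithinAt) injOn_sin_Ioo,
    intervalIntegral.integral_of_le (by positivity), MeasureTheory.integral_Ioc_eq_integral_Ioo]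
  exact MeasureTheory.setIntegral_congr_fun measurableSet_Ioo
    fun θ hθ => ellipticIntegrand_comp_sin hz hθ

/-- The power series of the complete elliptic integral: expand `1 / √(1 - z sin² θ)` in powers of
`z` and integrate termwise with Wallis' formula. -/
theorem hasSum_ellipticK {z : ℝ} (hz : |z| < 1) :
    HasSum (fun n : ℕ => ((n.centralBinom : ℝ) / 4 ^ n) ^ 2 * z ^ n)
      (2 / Real.pi * ellipticK z) := by
  have hw0 : ∀ n : ℕ, (0 : ℝ) ≤ (n.centralBinom : ℝ) / 4 ^ n := fun n => by positivity
  have key := intervalIntegral.hasSum_integral_of_dominated_convergence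
    (μ := MeasureTheory.volume) (a := 0) (b := Real.pi)
    (F := fun n θ => (n.centralBinom : ℝ) / 4 ^ n * (z * Real.sin θ ^ 2) ^ n)
    (f := fun θ => 1 / √(1 - z * Real.sin θ ^ 2))
    (fun n _ => |z| ^ n)
    (fun n => (by fun_prop : Continuous _).aestronglyMeasurable)
    (fun n => Filter.Eventually.of_forall fun θ _ => by
      have hs : Real.sin θ ^ 2 ≤ 1 := Real.sin_sq_le_one θ
      rw [norm_mul, norm_pow, norm_mul, Real.norm_eq_abs, abs_of_nonneg (hw0 n), Real.norm_eq_abs,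
        Real.norm_eq_abs, abs_of_nonneg (sq_nonneg (Real.sin θ))]
      calc _ ≤ 1 * (|z| * 1) ^ n := by
            gcongr
            exact centralBinom_div_four_pow_le_one n
        _ = _ := by rw [one_mul, mul_one])
    (Filter.Eventually.of_forall fun θ _ => summable_geometric_of_lt_one (abs_nonneg z) hz)
    intervalIntegrable_const
    (Filter.Eventually.of_forall fun θ _ => by
      refine hasSum_centralBinom_mul_pow ?_
      rw [abs_mul, abs_of_nonneg (sq_nonneg (Real.sin θ))]
      have hs : Real.sin θ ^ 2 ≤ 1 := Real.sin_sq_le_one θ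
      nlinarith [abs_nonneg z])
  have hpi := Real.pi_pos
  have hhalf := integral_zero_pi_eq_two_mul (f := fun x => 1 / √(1 - z * x ^ 2))
    (continuous_one_div_sqrt_sin hz)
  rw [hhalf, ← ellipticK_eq_integral_sin hz] at key
  convert! key.mul_left (1 / Real.pi) using 1
  · ext n
    simp only [mul_pow, ← pow_mul]
    rw [intervalIntegral.integral_const_mul, intervalIntegral.integral_const_mul,
      integral_sin_pow_even, ← centralBinom_div_four_pow_eq_prod]
    field_simp
  · ring

theorem hasSum_sqCentralBinom {t : ℝ} (ht : |t| < 1 / 16) :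
    HasSum (fun n : ℕ => sqCentralBinom n * t ^ n) (2 / Real.pi * ellipticK (16 * t)) := by
  have hz : |16 * t| < 1 := by
    rw [abs_mul, abs_of_pos (by norm_num : (0 : ℝ) < 16)]
    linarith
  refine (hasSum_ellipticK hz).congr_fun fun n => ?_
  rw [sqCentralBinom_eq, mul_pow]
  ring

/-! ### Moments of the tilted distributions -/

theorem sqCentralBinom_pos (n : ℕ) : 0 < sqCentralBinom n := by
  have : 0 < (2 * n).choose n := Nat.choose_pos (by omega)
  rw [sqCentralBinom]
  positivity

theorem sqCentralBinom_le (n : ℕ) : sqCentralBinom n ≤ 16 ^ n := by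
  rw [sqCentralBinom_eq]
  have h := centralBinom_div_four_pow_le_one n
  have h0 : (0 : ℝ) ≤ (n.centralBinom : ℝ) / 4 ^ n := by positivity
  have : ((n.centralBinom : ℝ) / 4 ^ n) ^ 2 ≤ 1 := by nlinarith
  exact mul_le_of_le_one_right (by positivity) this

/-- The unnormalised `r`-th moment `∑ n^r a_n t^n` of the weights `a_n t^n`. -/
noncomputable def momentSeries (r : ℕ) (t : ℝ) : ℝ :=
  ∑' n : ℕ, (n : ℝ) ^ r * (sqCentralBinom n * t ^ n)

theorem genFun_eq_momentSeries : genFun = momentSeries 0 := by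
  funext t
  simp [genFun, momentSeries]

theorem summable_momentSeries (r : ℕ) {t : ℝ} (ht : t ∈ Set.Ioo (0 : ℝ) (1 / 16)) :
    Summable fun n : ℕ => (n : ℝ) ^ r * (sqCentralBinom n * t ^ n) := by
  have h16 : ‖16 * t‖ < 1 := by
    rw [Real.norm_eq_abs, abs_of_pos (by linarith [ht.1])]
    linarith [ht.2]
  refine (summable_pow_mul_geometric_of_norm_lt_one r h16).of_nonneg_of_le (fun n => ?_) fun n => ?_
  · have := (sqCentralBinom_pos n).le
    have := ht.1.le
    positivity
  · rw [mul_pow]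
    have := ht.1.le
    gcongr
    exact sqCentralBinom_le n

theorem hasSum_momentSeries (r : ℕ) {t : ℝ} (ht : t ∈ Set.Ioo (0 : ℝ) (1 / 16)) :
    HasSum (fun n : ℕ => (n : ℝ) ^ r * (sqCentralBinom n * t ^ n)) (momentSeries r t) :=
  (summable_momentSeries r ht).hasSum

theorem one_le_momentSeries_zero {t : ℝ} (ht : t ∈ Set.Ioo (0 : ℝ) (1 / 16)) :
    1 ≤ momentSeries 0 t := by
  have := (summable_momentSeries 0 ht).le_tsum 0 fun n _ => by
    have := (sqCentralBinom_pos n).le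
    have := ht.1.le
    positivity
  simpa [momentSeries, sqCentralBinom] using this

/-- The operator `t d/dt` raises the order of the moment by one. -/
theorem hasDerivAt_momentSeries (r : ℕ) {t : ℝ} (ht : t ∈ Set.Ioo (0 : ℝ) (1 / 16)) :
    HasDerivAt (momentSeries r) (momentSeries (r + 1) t / t) t := by
  obtain ⟨ρ, htρ, hρ⟩ := exists_between ht.2
  have hρ0 : 0 < ρ := ht.1.trans htρ
  have hterm : ∀ (n : ℕ) (x : ℝ), 0 < x →
      (n : ℝ) ^ r * (sqCentralBinom n * (n * x ^ (n - 1))) =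
        (n : ℝ) ^ (r + 1) * (sqCentralBinom n * x ^ n) / x := by
    intro n x hx
    rcases n with _ | n
    · simp
    · rw [Nat.add_sub_cancel, pow_succ x]
      field_simp
      ring
  have key := hasDerivAt_tsum_of_isPreconnected
    (u := fun n : ℕ => (n : ℝ) ^ (r + 1) * (sqCentralBinom n * ρ ^ n) / ρ)
    (t := Set.Ioo 0 ρ)
    (g := fun (n : ℕ) x => (n : ℝ) ^ r * (sqCentralBinom n * x ^ n))
    (g' := fun (n : ℕ) x => (n : ℝ) ^ r * (sqCentralBinom n * (n * x ^ (n - 1))))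
    ((summable_momentSeries (r + 1) ⟨hρ0, hρ⟩).div_const ρ) isOpen_Ioo isPreconnected_Ioo
    (fun n x _ => ((hasDerivAt_pow n x).const_mul _).const_mul _)
    (fun n x hx => by
      rw [← hterm n ρ hρ0, Real.norm_eq_abs, abs_of_nonneg]
      · have := (sqCentralBinom_pos n).le
        have := hx.1.le
        have := hx.2.le
        gcongr
      · have := (sqCentralBinom_pos n).le
        have := hx.1.le
        positivity)
    (y₀ := t) ⟨ht.1, htρ⟩ (summable_momentSeries r ht) (y := t) ⟨ht.1, htρ⟩
  convert! key using 1
  simp only [hterm _ t ht.1]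
  rw [tsum_div_const]
  rfl

/-- The mean of the distribution with weights proportional to `a_n t^n`. -/
noncomputable def tiltedMean (t : ℝ) : ℝ := momentSeries 1 t / momentSeries 0 t

/-- The variance of the distribution with weights proportional to `a_n t^n`. -/
noncomputable def tiltedVariance (t : ℝ) : ℝ :=
  momentSeries 2 t / momentSeries 0 t - tiltedMean t ^ 2

theorem hasDerivAt_tiltedMean {t : ℝ} (ht : t ∈ Set.Ioo (0 : ℝ) (1 / 16)) :
    HasDerivAt tiltedMean (tiltedVariance t / t) t := by
  have h0 : momentSeries 0 t ≠ 0 := (zero_lt_one.trans_le (one_le_momentSeries_zero ht)).ne'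
  have ht0 : t ≠ 0 := ht.1.ne'
  convert! (hasDerivAt_momentSeries 1 ht).div (hasDerivAt_momentSeries 0 ht) h0 using 1
  rw [tiltedVariance, tiltedMean]
  field_simp

theorem hasDerivAt_log_genFun {t : ℝ} (ht : t ∈ Set.Ioo (0 : ℝ) (1 / 16)) :
    HasDerivAt (fun s => Real.log (genFun s)) (tiltedMean t / t) t := by
  have h0 : momentSeries 0 t ≠ 0 := (zero_lt_one.trans_le (one_le_momentSeries_zero ht)).ne'
  rw [genFun_eq_momentSeries]
  convert! (hasDerivAt_momentSeries 0 ht).log h0 using 1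
  rw [tiltedMean, div_right_comm]

theorem circleVariance_eq_tiltedVariance {t : ℝ} (ht : t ∈ Set.Ioo (0 : ℝ) (1 / 16)) :
    circleVariance t = tiltedVariance t := by
  have ht0 : t ≠ 0 := ht.1.ne'
  have hev : deriv (fun s => Real.log (genFun s)) =ᶠ[𝓝 t] fun s => tiltedMean s / s := by
    filter_upwards [isOpen_Ioo.mem_nhds ht] with s hs
    exact (hasDerivAt_log_genFun hs).deriv
  have h2 : iteratedDeriv 2 (fun s => Real.log (genFun s)) t =
      (tiltedVariance t / t * t - tiltedMean t * 1) / t ^ 2 := by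
    rw [iteratedDeriv_succ, iteratedDeriv_one, hev.deriv_eq]
    exact ((hasDerivAt_tiltedMean ht).div (hasDerivAt_id t) ht0).deriv
  rw [circleVariance, h2, (hasDerivAt_log_genFun ht).deriv]
  field_simp
  ring

theorem hasSum_tilted_pow (r : ℕ) {t : ℝ} (ht : t ∈ Set.Ioo (0 : ℝ) (1 / 16)) :
    HasSum (fun j : ℕ => sqCentralBinom j * t ^ j / genFun t * (j : ℝ) ^ r)
      (momentSeries r t / momentSeries 0 t) := by
  rw [genFun_eq_momentSeries]
  refine ((hasSum_momentSeries r ht).div_const _).congr_fun fun j => ?_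
  ring

theorem tilted_nonneg {t : ℝ} (ht : t ∈ Set.Ioo (0 : ℝ) (1 / 16)) (j : ℕ) :
    0 ≤ sqCentralBinom j * t ^ j / genFun t := by
  have h0 := one_le_momentSeries_zero ht
  rw [← genFun_eq_momentSeries] at h0
  have := (sqCentralBinom_pos j).le
  have := ht.1.le
  positivity

theorem hasSum_tilted {t : ℝ} (ht : t ∈ Set.Ioo (0 : ℝ) (1 / 16)) :
    HasSum (fun j : ℕ => sqCentralBinom j * t ^ j / genFun t) 1 := by
  have h0 : momentSeries 0 t ≠ 0 := (zero_lt_one.trans_le (one_le_momentSeries_zero ht)).ne'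
  simpa [div_self h0] using hasSum_tilted_pow 0 ht

theorem hasSum_tilted_mul_sq_sub {t : ℝ} (ht : t ∈ Set.Ioo (0 : ℝ) (1 / 16)) :
    HasSum (fun j : ℕ => sqCentralBinom j * t ^ j / genFun t * (j - tiltedMean t) ^ 2)
      (tiltedVariance t) := by
  have h := ((hasSum_tilted_pow 2 ht).sub ((hasSum_tilted_pow 1 ht).mul_right
    (2 * tiltedMean t))).add ((hasSum_tilted ht).mul_right (tiltedMean t ^ 2))
  convert! h using 1
  · ext j; ring
  · rw [tiltedVariance, ← tiltedMean]; ring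

theorem momentSeries_one_pos {t : ℝ} (ht : t ∈ Set.Ioo (0 : ℝ) (1 / 16)) :
    0 < momentSeries 1 t := by
  refine (summable_momentSeries 1 ht).tsum_pos (fun n => ?_) 1 ?_
  · have := (sqCentralBinom_pos n).le
    have := ht.1.le
    positivity
  · have := sqCentralBinom_pos 1
    have := ht.1
    positivity

theorem tiltedMean_pos {t : ℝ} (ht : t ∈ Set.Ioo (0 : ℝ) (1 / 16)) : 0 < tiltedMean t :=
  div_pos (momentSeries_one_pos ht) (zero_lt_one.trans_le (one_le_momentSeries_zero ht))

theorem tiltedVariance_pos {t : ℝ} (ht : t ∈ Set.Ioo (0 : ℝ) (1 / 16)) : 0 < tiltedVariance t := by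
  have h := hasSum_tilted_mul_sq_sub ht
  have h0 := zero_lt_one.trans_le (one_le_momentSeries_zero ht)
  rw [← genFun_eq_momentSeries] at h0
  rw [← h.tsum_eq]
  -- the mean is positive, so the atom at `0` contributes to the variance
  refine h.summable.tsum_pos (fun j => mul_nonneg (tilted_nonneg ht j) (sq_nonneg _)) 0 ?_
  have h1 := sqCentralBinom_pos 0
  have h2 := tiltedMean_pos ht
  rw [Nat.cast_zero, zero_sub, neg_sq, pow_zero]
  positivity

theorem abs_sub_pow_three_le {x y : ℝ} (hx : 0 ≤ x) (hy : 0 ≤ y) :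
    |x - y| ^ 3 ≤ x ^ 3 + y ^ 3 := by
  rcases le_total x y with h | h
  · rw [abs_of_nonpos (by linarith)]
    have : (-(x - y)) ^ 3 ≤ y ^ 3 := pow_le_pow_left₀ (by linarith) (by linarith) 3
    have := pow_nonneg hx 3
    linarith
  · rw [abs_of_nonneg (by linarith)]
    have : (x - y) ^ 3 ≤ x ^ 3 := pow_le_pow_left₀ (by linarith) (by linarith) 3
    have := pow_nonneg hy 3
    linarith

theorem tilted_third_moment {t : ℝ} (ht : t ∈ Set.Ioo (0 : ℝ) (1 / 16)) :
    (Summable fun j : ℕ => sqCentralBinom j * t ^ j / genFun t * |(j : ℝ) - tiltedMean t| ^ 3) ∧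
      ∑' j : ℕ, sqCentralBinom j * t ^ j / genFun t * |(j : ℝ) - tiltedMean t| ^ 3 ≤
        momentSeries 3 t / momentSeries 0 t + tiltedMean t ^ 3 := by
  have h := (hasSum_tilted_pow 3 ht).add ((hasSum_tilted ht).mul_right (tiltedMean t ^ 3))
  rw [one_mul] at h
  have hle : ∀ j : ℕ, sqCentralBinom j * t ^ j / genFun t * |(j : ℝ) - tiltedMean t| ^ 3 ≤
      sqCentralBinom j * t ^ j / genFun t * (j : ℝ) ^ 3
        + sqCentralBinom j * t ^ j / genFun t * tiltedMean t ^ 3 := by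
    intro j
    rw [← mul_add]
    exact mul_le_mul_of_nonneg_left
      (abs_sub_pow_three_le (Nat.cast_nonneg j) (tiltedMean_pos ht).le) (tilted_nonneg ht j)
  have hs := h.summable.of_nonneg_of_le
    (fun j => mul_nonneg (tilted_nonneg ht j) (by positivity)) hle
  refine ⟨hs, ?_⟩
  rw [← h.tsum_eq]
  exact hs.tsum_le_tsum hle h.summable

/-! ### The saddle point -/

theorem strictMonoOn_tiltedMean : StrictMonoOn tiltedMean (Set.Ioo (0 : ℝ) (1 / 16)) := by
  refine strictMonoOn_of_deriv_pos (convex_Ioo _ _)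
    (fun t ht => (hasDerivAt_tiltedMean ht).continuousAt.continuousWithinAt) fun t ht => ?_
  rw [interior_Ioo] at ht
  rw [(hasDerivAt_tiltedMean ht).deriv]
  exact div_pos (tiltedVariance_pos ht) ht.1

/-- An argument depends continuously on its mean. -/
theorem tendsto_of_tendsto_tiltedMean {ι : Type*} {l : Filter ι} {u : ι → ℝ} {t : ℝ}
    (hu : ∀ᶠ i in l, u i ∈ Set.Ioo (0 : ℝ) (1 / 16)) (ht : t ∈ Set.Ioo (0 : ℝ) (1 / 16))
    (h : Tendsto (fun i => tiltedMean (u i)) l (𝓝 (tiltedMean t))) : Tendsto u l (𝓝 t) := by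
  refine tendsto_order.2 ⟨fun a ha => ?_, fun b hb => ?_⟩
  · rcases le_or_gt a 0 with ha0 | ha0
    · filter_upwards [hu] with i hi using ha0.trans_lt hi.1
    · have ha' : a ∈ Set.Ioo (0 : ℝ) (1 / 16) := ⟨ha0, ha.trans ht.2⟩
      filter_upwards [hu, h.eventually_const_lt (strictMonoOn_tiltedMean ha' ht ha)] with i hi hi'
      exact (strictMonoOn_tiltedMean.lt_iff_lt ha' hi).1 hi'
  · rcases le_or_gt (1 / 16) b with hb0 | hb0
    · filter_upwards [hu] with i hi using hi.2.trans_le hb0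
    · have hb' : b ∈ Set.Ioo (0 : ℝ) (1 / 16) := ⟨ht.1.trans hb, hb0⟩
      filter_upwards [hu, h.eventually_lt_const (strictMonoOn_tiltedMean ht hb' hb)] with i hi hi'
      exact (strictMonoOn_tiltedMean.lt_iff_lt hi hb').1 hi'

/-- A lower bound of the order given by Wallis' product; it makes `∑ a_n / 16^n` diverge. -/
theorem one_div_four_mul_le_sq_centralBinom_div (n : ℕ) (hn : 1 ≤ n) :
    1 / (4 * n : ℝ) ≤ ((n.centralBinom : ℝ) / 4 ^ n) ^ 2 := by
  induction n, hn using Nat.le_induction with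
  | base => norm_num [Nat.centralBinom]
  | succ n hn ih =>
    have hn' : (1 : ℝ) ≤ n := by exact_mod_cast hn
    rw [centralBinom_succ_div_four_pow, mul_pow]
    calc 1 / (4 * ((n + 1 : ℕ) : ℝ)) ≤ 1 / (4 * n) * ((2 * n + 1) / (2 * n + 2)) ^ 2 := by
          push_cast
          rw [div_pow, div_mul_div_comm, div_le_div_iff₀ (by positivity) (by positivity)]
          nlinarith
      _ ≤ _ := by gcongr

/-- The generating function blows up at its radius of convergence, because
`a_n / 16^n ≥ 1 / (4n)`. -/
theorem tendsto_genFun_atTop : Tendsto genFun (𝓝[<] (1 / 16)) atTop := by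
  have hdiv : Tendsto (fun N => ∑ n ∈ Finset.range N, sqCentralBinom n * (1 / 16) ^ n)
      atTop atTop := by
    have hnn : ∀ n, 0 ≤ sqCentralBinom n * (1 / 16) ^ n := fun n => by
      have := (sqCentralBinom_pos n).le
      positivity
    refine (not_summable_iff_tendsto_nat_atTop_of_nonneg hnn).1 fun hs => ?_
    refine Real.not_summable_one_div_natCast ?_
    refine (hs.mul_left 4).of_nonneg_of_le (fun n => by positivity) fun n => ?_
    rcases Nat.eq_zero_or_pos n with rfl | hn
    · simp [(sqCentralBinom_pos 0).le]
    · have := one_div_four_mul_le_sq_centralBinom_div n hn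
      have h16 : (16 : ℝ) ^ n * (1 / 16) ^ n = 1 := by rw [← mul_pow]; norm_num
      rw [sqCentralBinom_eq, mul_right_comm, h16, one_mul]
      have h4 : 1 / (n : ℝ) = 4 * (1 / (4 * n)) := by field_simp
      rw [h4]
      gcongr
  refine tendsto_atTop.2 fun B => ?_
  obtain ⟨N, hN⟩ := (hdiv.eventually_gt_atTop B).exists
  have hcont : Continuous fun t : ℝ => ∑ n ∈ Finset.range N, sqCentralBinom n * t ^ n := by fun_prop
  -- a partial sum exceeding `B` at `1/16` still exceeds `B` slightly to the left of `1/16`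
  have hev := ((hcont.tendsto (1 / 16)).mono_left
    (nhdsWithin_le_nhds (s := Set.Iio (1 / 16)))).eventually_const_lt hN
  filter_upwards [hev, Ioo_mem_nhdsLT (by norm_num : (0 : ℝ) < 1 / 16)] with t h1 ht
  refine h1.le.trans ?_
  have := (summable_momentSeries 0 ht).sum_le_tsum (Finset.range N) fun n _ => by
    have := (sqCentralBinom_pos n).le
    have := ht.1.le
    positivity
  simpa [genFun] using this

theorem hasDerivAt_circleObjective (κ : ℝ) {t : ℝ} (ht : t ∈ Set.Ioo (0 : ℝ) (1 / 16)) :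
    HasDerivAt (circleObjective κ) (κ * (tiltedMean t / t) - t⁻¹) t :=
  ((hasDerivAt_log_genFun ht).const_mul κ).sub (Real.hasDerivAt_log ht.1.ne')

/-- The saddle point equation. -/
theorem IsCircleArgMin.mul_tiltedMean {κ t : ℝ} (h : IsCircleArgMin κ t) :
    κ * tiltedMean t = 1 := by
  have ht0 : t ≠ 0 := h.1.1.ne'
  have := (h.2.isLocalMin (isOpen_Ioo.mem_nhds h.1)).hasDerivAt_eq_zero
    (hasDerivAt_circleObjective κ h.1)
  field_simp at this
  linarith

theorem IsCircleArgMin.unique {κ s t : ℝ} (hs : IsCircleArgMin κ s) (ht : IsCircleArgMin κ t) :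
    s = t := by
  have h1 := hs.mul_tiltedMean
  have h2 := ht.mul_tiltedMean
  refine strictMonoOn_tiltedMean.injOn hs.1 ht.1 ?_
  have hκ : κ ≠ 0 := by
    rintro rfl
    simp at h1
  exact mul_left_cancel₀ hκ (h1.trans h2.symm)

/-- The objective is coercive on `(0, 1/16)`: `-ln t` blows up at `0`, and `ln g` at `1/16`. -/
theorem exists_isCircleArgMin {κ : ℝ} (hκ : 0 < κ) : ∃ t, IsCircleArgMin κ t := by
  have hlog : ∀ t ∈ Set.Ioo (0 : ℝ) (1 / 16), 0 ≤ Real.log (genFun t) ∧ 0 ≤ -Real.log t := by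
    intro t ht
    rw [genFun_eq_momentSeries]
    exact ⟨Real.log_nonneg (one_le_momentSeries_zero ht),
      neg_nonneg.2 (Real.log_nonpos ht.1.le (by linarith [ht.2]))⟩
  -- an arbitrary reference point: outside a compact interval the objective exceeds its value there
  set t₀ : ℝ := 1 / 32 with ht₀
  have ht₀' : t₀ ∈ Set.Ioo (0 : ℝ) (1 / 16) := by rw [ht₀]; constructor <;> norm_num
  have hleft : ∀ᶠ t in 𝓝[>] (0 : ℝ), circleObjective κ t₀ < -Real.log t :=
    (tendsto_neg_atBot_atTop.comp Real.tendsto_log_nhdsGT_zero).eventually_gt_atTop _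
  have hright : ∀ᶠ t in 𝓝[<] (1 / 16 : ℝ), circleObjective κ t₀ < κ * Real.log (genFun t) :=
    ((Real.tendsto_log_atTop.comp tendsto_genFun_atTop).const_mul_atTop hκ).eventually_gt_atTop _
  obtain ⟨a, ha0, ha⟩ := mem_nhdsGT_iff_exists_Ioo_subset.1 hleft
  obtain ⟨b, hb1, hb⟩ := mem_nhdsLT_iff_exists_Ioo_subset.1 hright
  simp only [Set.mem_Ioi, Set.mem_Iio] at ha0 hb1
  have hout : ∀ t ∈ Set.Ioo (0 : ℝ) (1 / 16), t < a ∨ b < t →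
      circleObjective κ t₀ < circleObjective κ t := by
    intro t ht h
    have h1 := hlog t ht
    have h2 := mul_nonneg hκ.le h1.1
    rw [circleObjective.eq_def κ t]
    rcases h with h | h
    · have : circleObjective κ t₀ < -Real.log t := ha ⟨ht.1, h⟩
      linarith
    · have : circleObjective κ t₀ < κ * Real.log (genFun t) := hb ⟨h, ht.2⟩
      linarith
  have hsub : Set.Icc a b ⊆ Set.Ioo (0 : ℝ) (1 / 16) :=
    fun t ht => ⟨ha0.trans_le ht.1, ht.2.trans_lt hb1⟩
  have hin : t₀ ∈ Set.Icc a b := by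
    by_contra hnot
    rw [Set.mem_Icc, not_and_or, not_le, not_le] at hnot
    exact lt_irrefl _ (hout t₀ ht₀' hnot)
  obtain ⟨t, ht, hmin⟩ := isCompact_Icc.exists_isMinOn ⟨t₀, hin⟩
    (fun s hs => (hasDerivAt_circleObjective κ (hsub hs)).continuousAt.continuousWithinAt)
  refine ⟨t, hsub ht, fun s hs => ?_⟩
  by_cases hs' : s ∈ Set.Icc a b
  · exact hmin hs'
  · rw [Set.mem_Icc, not_and_or, not_le, not_le] at hs'
    exact (hmin hin).trans (hout s hs hs').le

/-! ### The asymptotic formula -/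

theorem continuousAt_momentSeries (r : ℕ) {t : ℝ} (ht : t ∈ Set.Ioo (0 : ℝ) (1 / 16)) :
    ContinuousAt (momentSeries r) t :=
  (hasDerivAt_momentSeries r ht).continuousAt

/-- The local limit theorem for the tilted distributions whose parameters `u n` solve the saddle
point equation `tiltedMean (u n) = n / k n`. -/
theorem tendsto_sqrt_mul_tilted_convolution {k : ℕ → ℕ} (hk : Tendsto k atTop atTop) {u : ℕ → ℝ}
    {t : ℝ} (ht : t ∈ Set.Ioo (0 : ℝ) (1 / 16)) (hut : Tendsto u atTop (𝓝 t))
    (hu : ∀ᶠ n in atTop, tiltedMean (u n) = n / k n) :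
    Tendsto (fun n => √(k n) * (multifoldConvolution sqCentralBinom (k n) n * u n ^ n /
      genFun (u n) ^ k n)) atTop (𝓝 (1 / √(2 * Real.pi * tiltedVariance t))) := by
  have hmem : ∀ᶠ n in atTop, u n ∈ Set.Ioo (0 : ℝ) (1 / 16) := hut (isOpen_Ioo.mem_nhds ht)
  have h0 : momentSeries 0 t ≠ 0 := (zero_lt_one.trans_le (one_le_momentSeries_zero ht)).ne'
  have hpos := zero_lt_one.trans_le (one_le_momentSeries_zero ht)
  have hS := fun r => (continuousAt_momentSeries r ht).tendsto.comp hut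
  have hmean : Tendsto (fun n => tiltedMean (u n)) atTop (𝓝 (tiltedMean t)) :=
    (hS 1).div (hS 0) h0
  have hvar : Tendsto (fun n => tiltedVariance (u n)) atTop (𝓝 (tiltedVariance t)) :=
    ((hS 2).div (hS 0) h0).sub (hmean.pow 2)
  have hthird := ((hS 3).div (hS 0) h0).add (hmean.pow 3)
  have hatoms : Tendsto (fun n => 4 * u n / momentSeries 0 (u n) ^ 2) atTop
      (𝓝 (4 * t / momentSeries 0 t ^ 2)) :=
    (hut.const_mul 4).div ((hS 0).pow 2) (pow_ne_zero 2 h0)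
  have hc : 0 < 4 * t / momentSeries 0 t ^ 2 := by
    have := ht.1
    positivity
  simp only [← multifoldConvolution_tilt]
  refine tendsto_sqrt_mul_multifoldConvolution
    (p := fun n j => sqCentralBinom j * u n ^ j / genFun (u n))
    (V := fun n => tiltedVariance (u n))
    (C := momentSeries 3 t / momentSeries 0 t + tiltedMean t ^ 3 + 1) hk (half_pos hc)
    (tiltedVariance_pos ht) (hmem.mono fun n h => tilted_nonneg h)
    (hmem.mono fun n h => hasSum_tilted h)
    ?_ ?_ ?_ ?_ ?_ hvar
  · filter_upwards [hmem, hu] with n h h'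
    rw [← h']
    simpa [tiltedMean] using hasSum_tilted_pow 1 h
  · filter_upwards [hmem, hu] with n h h'
    simpa only [← h'] using hasSum_tilted_mul_sq_sub h
  · filter_upwards [hmem, hu] with n h h'
    simpa only [← h'] using (tilted_third_moment h).1
  · filter_upwards [hmem, hu, hthird.eventually_lt_const (lt_add_one _)] with n h h' h''
    simp only [← h']
    exact (tilted_third_moment h).2.trans h''.le
  · -- the product of the atoms at `0` and `1` is `a_0 a_1 t / g(t)² = 4t / g(t)²`
    filter_upwards [hatoms.eventually_const_lt (half_lt_self hc)] with n h
    refine h.le.trans_eq ?_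
    rw [genFun_eq_momentSeries]
    simp [sqCentralBinom]
    ring

/-- The asymptotic formula for an arbitrary choice `T` of minimisers. Since
`tiltedMean (T κ) = κ⁻¹`, convergence `k n / n → κ` gives `T (k n / n) → T κ`, and the prefactor
`g^k / T^n` of the local limit theorem is exactly the exponential. -/
theorem isEquivalent_multifoldConvolution {T : ℝ → ℝ} (hT : ∀ κ, 0 < κ → IsCircleArgMin κ (T κ))
    {κ : ℝ} (hκ : 0 < κ) {k : ℕ → ℕ}
    (hk : Tendsto (fun n : ℕ => (k n : ℝ) / (n : ℝ)) atTop (𝓝 κ)) :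
    (fun n : ℕ => multifoldConvolution sqCentralBinom (k n) n) ~[atTop]
      (fun n : ℕ =>
        Real.exp ((k n : ℝ) * Real.log (genFun (T ((k n : ℝ) / (n : ℝ))))
            - (n : ℝ) * Real.log (T ((k n : ℝ) / (n : ℝ))))
          * (1 / √(2 * Real.pi * (k n : ℝ) * circleVariance (T κ)))) := by
  have hTκ := (hT κ hκ).1
  have hmean : ∀ κ, 0 < κ → tiltedMean (T κ) = κ⁻¹ := fun κ h =>
    eq_inv_of_mul_eq_one_right (hT κ h).mul_tiltedMean
  have hpos : ∀ᶠ n : ℕ in atTop, 0 < (k n : ℝ) / n := hk.eventually_const_lt hκ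
  have hkR : Tendsto (fun n => (k n : ℝ)) atTop atTop := by
    refine (hk.pos_mul_atTop hκ tendsto_natCast_atTop_atTop).congr' ?_
    filter_upwards [eventually_ge_atTop 1] with n hn
    have : (n : ℝ) ≠ 0 := by exact_mod_cast (by omega : n ≠ 0)
    field_simp
  set u : ℕ → ℝ := fun n => T ((k n : ℝ) / n) with hu_def
  have humem : ∀ᶠ n in atTop, u n ∈ Set.Ioo (0 : ℝ) (1 / 16) := hpos.mono fun n h => (hT _ h).1
  have hu : ∀ᶠ n : ℕ in atTop, tiltedMean (u n) = n / k n := hpos.mono fun n h => by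
    rw [hu_def, hmean _ h, inv_div]
  have hut : Tendsto u atTop (𝓝 (T κ)) := by
    refine tendsto_of_tendsto_tiltedMean humem hTκ ?_
    rw [hmean κ hκ]
    refine (hk.inv₀ hκ.ne').congr' ?_
    filter_upwards [hpos] with n h
    rw [hu_def, hmean _ h]
  have hv := tiltedVariance_pos hTκ
  have hpi := Real.pi_pos
  have hlocal := tendsto_sqrt_mul_tilted_convolution (tendsto_natCast_atTop_iff.1 hkR) hTκ hut hu
  rw [circleVariance_eq_tiltedVariance hTκ]
  refine isEquivalent_of_tendsto_one ?_
  have hone := hlocal.mul_const (√(2 * Real.pi * tiltedVariance (T κ)))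
  rw [one_div_mul_cancel (Real.sqrt_pos.2 (by positivity)).ne'] at hone
  refine hone.congr' ?_
  filter_upwards [humem, hkR.eventually_gt_atTop 0] with n h hkn
  have hg : 0 < genFun (u n) := by
    rw [genFun_eq_momentSeries]
    exact zero_lt_one.trans_le (one_le_momentSeries_zero h)
  have hexp : Real.exp ((k n : ℝ) * Real.log (genFun (u n)) - n * Real.log (u n)) =
      genFun (u n) ^ k n / u n ^ n := by
    rw [Real.exp_sub, Real.exp_nat_mul, Real.exp_nat_mul, Real.exp_log hg, Real.exp_log h.1]
  have hsqrt : √(2 * Real.pi * (k n : ℝ) * tiltedVariance (T κ)) =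
      √(k n) * √(2 * Real.pi * tiltedVariance (T κ)) := by
    rw [← Real.sqrt_mul hkn.le]
    congr 1
    ring
  have h1 : 0 < √(k n : ℝ) := Real.sqrt_pos.2 hkn
  have h2 : 0 < √(2 * Real.pi * tiltedVariance (T κ)) := Real.sqrt_pos.2 (by positivity)
  have hun := h.1
  rw [Pi.div_apply]
  change _ = _ / (Real.exp ((k n : ℝ) * Real.log (genFun (u n)) - n * Real.log (u n)) * _)
  rw [hexp, hsqrt]
  field_simp

theorem mainTheorem1 :
    (∀ t : ℝ, |t| < 1 / 16 →
      IntervalIntegrable (ellipticIntegrand (16 * t)) MeasureTheory.volume 0 1 ∧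
      HasSum (fun n : ℕ => sqCentralBinom n * t ^ n) (2 / Real.pi * ellipticK (16 * t))) ∧
    ∃ T : ℝ → ℝ,
      (∀ κ : ℝ, 0 < κ → IsCircleArgMin κ (T κ) ∧ ∀ t : ℝ, IsCircleArgMin κ t → t = T κ) ∧
      ∀ κ : ℝ, 0 < κ → ∀ k : ℕ → ℕ,
        Tendsto (fun n : ℕ => (k n : ℝ) / (n : ℝ)) atTop (𝓝 κ) →
        (fun n : ℕ => multifoldConvolution sqCentralBinom (k n) n) ~[atTop]
          (fun n : ℕ =>
            Real.exp ((k n : ℝ) * Real.log (genFun (T ((k n : ℝ) / (n : ℝ))))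
                - (n : ℝ) * Real.log (T ((k n : ℝ) / (n : ℝ))))
              * (1 / √(2 * Real.pi * (k n : ℝ) * circleVariance (T κ)))) := by
  refine ⟨fun t ht => ⟨?_, hasSum_sqCentralBinom ht⟩, ?_⟩
  · refine intervalIntegrable_ellipticIntegrand ?_
    rw [abs_mul, abs_of_pos (by norm_num : (0 : ℝ) < 16)]
    linarith
  · choose! T hT using fun (κ : ℝ) (hκ : 0 < κ) => exists_isCircleArgMin hκ
    exact ⟨T, fun κ hκ => ⟨hT κ hκ, fun t ht => ht.unique (hT κ hκ)⟩,
      fun κ hκ k hk => isEquivalent_multifoldConvolution hT hκ hk⟩
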